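/- Sequences are binary, i.e. over $\mathbb{Z}_2$. A word of length $m$ is aperiodic if it is not a repetition of a word whose length is a proper divisor of $m$. The nonlinear complexity $nlc(\mathbf{s})$ of a finite or infinite sequence $\mathbf{s}$ is the length of the shortest (not necessarily linear) feedback shift register that generates $\mathbf{s}$. For $\mathbf{s}_n=(s_0,\dots,s_{n-1})$, let $\mathbf{s}_n^\infty$ be the periodic sequence $\mathbf{s}_n\mathbf{s}_n\cdots$, and let $R^k(\mathbf{s}_n)=(s_{n-k},\dots,s_{n-1},s_0,\dots,s_{n-k-1})$. For $c\ge\lfloor n/2\rfloor$ and $1\le d\le\min\{n-c,\lfloor n/2\rfloor\}$, let $\mathcal{B}(n,c,d)$ be the set of aperiodic $\mathbf{s}_n$ such that $(s_0,\dots,s_{d-1})$ is aperiodic, $s_j=s_{j \bmod d}$ for $0\le j<c+d-1$, and $s_{c+d-1}=s_{(c+d-1)\bmod d}+1$. Let $\mathcal{B}(n,c)=\bigcup_{d}\mathcal{B}(n,c,d)$; this union is disjoint. For $\mathbf{s}_n\in\mathcal{B}(n,c,d)$, let $add(\mathbf{s}_n)$ be the least $t\ge 0$ with $s_{n-1-t}\ne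 s_{(d-1-t)\bmod d}$. Put $E(\mathbf{s}_n)=\{R^k(\mathbf{s}_n):0\le k<n\}\cap\mathcal{B}(n,c)$, and let $$\mathcal{R}(n,c)=\bigcup_{\mathbf{s}_n\in\mathcal{B}(n,c)}\{\mathbf{r}_n\in E(\mathbf{s}_n): add(\mathbf{r}_n)\ge add(\mathbf{a}_n)\text{ for all }\mathbf{a}_n\in E(\mathbf{s}_n)\}$$ be the set of representative sequences. Theorem. Let $n\ge1$. (1) If $\mathbf{s}_n\in\mathcal{B}(n,c)$ with $c\ge\lfloor 3n/4\rfloor$, then $\mathbf{s}_n\in\mathcal{R}(n,c)$ and $nlc(\mathbf{s}_n^\infty)=nlc(\mathbf{s}_n)+add(\mathbf{s}_n)$. (2) Let $$c_0=\begin{cases}\lfloor 3n/4\rfloor-1,& n=8k,\\ \lfloor 3n/4\rfloor,& n=8k+2\text{ or }n=8k+6,\\ \lfloor 3n/4\rfloor-2,& n=8k+4,\ k\ge2,\end{cases}$$ where $k$ is an integer. Then $c_0$ is the tight bound: it is the least integer $c_0\ge\lfloor n/2\rfloor$ such that $\mathcal{B}(n,c)\subseteq\mathcal{R}(n,c)$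 for all $c\ge c_0$. Moreover, $nlc(\mathbf{s}_n^\infty)=nlc(\mathbf{s}_n)+add(\mathbf{s}_n)$ for all $\mathbf{s}_n\in\mathcal{B}(n,c)$ with $c\ge c_0$. -/

import Mathlib

namespace NLC

/-- A binary sequence `(s_0, …, s_{n-1})` of length `n`. -/
abbrev BinSeq (n : ℕ) : Type := Fin n → ZMod 2

/-- The infinite periodic sequence obtained by repeating `s`. For `i < n` its `i`-th term is `s_i`,
so it also serves to address the terms of `s` by natural numbers. -/
def periodize {n : ℕ} [NeZero n] (s : BinSeq n) : ℕ → ZMod 2 :=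
  fun i => s (Fin.ofNat n i)

/-- The first `N` terms (all of them if `N = ⊤`) of `u` are generated by the feedback shift register
of length `m` with the feedback function `f`. -/
def Generates (m : ℕ) (f : (Fin m → ZMod 2) → ZMod 2) (u : ℕ → ZMod 2) (N : ℕ∞) : Prop :=
  ∀ i : ℕ, ((i + m : ℕ) : ℕ∞) < N → u (i + m) = f (fun j => u (i + j))

/-- The length of the shortest feedback shift register that generates the first `N` terms
of `u`. -/
noncomputable def nlcUpTo (u : ℕ → ZMod 2) (N : ℕ∞) : ℕ :=
  sInf {m | ∃ f : (Fin m → ZMod 2) → ZMod 2, Generates m f u N}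

/-- The nonlinear complexity of the finite sequence `s`. -/
noncomputable def nlc {n : ℕ} [NeZero n] (s : BinSeq n) : ℕ :=
  nlcUpTo (periodize s) n

/-- The nonlinear complexity of the periodic sequence `s^∞`. -/
noncomputable def nlcPeriodic {n : ℕ} [NeZero n] (s : BinSeq n) : ℕ :=
  nlcUpTo (periodize s) ⊤

/-- The word formed by the first `d` terms of `u` is aperiodic: it is not a repetition of a word
whose length is a proper divisor of `d`. -/
def AperiodicPrefix (u : ℕ → ZMod 2) (d : ℕ) : Prop :=
  ¬ ∃ e ∈ d.properDivisors, ∀ i < d, u i = u (i % e)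

/-- The set `B(n, c, d)`: aperiodic `s` whose first `d` terms form an aperiodic word, whose first
`c + d - 1` terms repeat that word, and whose next term breaks the repetition. -/
def B (n c d : ℕ) [NeZero n] : Set (BinSeq n) :=
  {s | n / 2 ≤ c ∧ 1 ≤ d ∧ d ≤ min (n - c) (n / 2) ∧
    AperiodicPrefix (periodize s) n ∧
    AperiodicPrefix (periodize s) d ∧
    (∀ j < c + d - 1, periodize s j = periodize s (j % d)) ∧
    periodize s (c + d - 1) = periodize s ((c + d - 1) % d) + 1}

/-- The set `B(n, c)`, the union of the sets `B(n, c, d)` over all spacings `d`. -/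
def BUnion (n c : ℕ) [NeZero n] : Set (BinSeq n) :=
  {s | ∃ d, s ∈ B n c d}

/-- The spacing of `s ∈ B(n, c)`: the `d` with `s ∈ B(n, c, d)` (there is only one). -/
noncomputable def spacing {n : ℕ} [NeZero n] (c : ℕ) (s : BinSeq n) : ℕ :=
  sInf {d | s ∈ B n c d}

/-- The number of added terms of `s` with respect to the spacing `d`: the first `t` with
`s_{n-1-t} ≠ s_{(d-1-t) mod d}`. -/
noncomputable def addOfSpacing {n : ℕ} [NeZero n] (d : ℕ) (s : BinSeq n) : ℕ :=
  sInf {t | t < n ∧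
    periodize s (n - 1 - t) ≠ periodize s ((((d : ℤ) - 1 - t) % (d : ℤ)).toNat)}

/-- `add(s)`, the number of added terms of `s ∈ B(n, c)`. -/
noncomputable def add {n : ℕ} [NeZero n] (c : ℕ) (s : BinSeq n) : ℕ :=
  addOfSpacing (spacing c s) s

/-- The right circular shift `R^k(s) = (s_{n-k}, …, s_{n-1}, s_0, …, s_{n-k-1})`. -/
def rotR {n : ℕ} (k : Fin n) (s : BinSeq n) : BinSeq n :=
  fun i => s (i - k)

/-- `E(s) = {R^k(s) : 0 ≤ k < n} ∩ B(n, c)`. -/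
def E {n : ℕ} [NeZero n] (c : ℕ) (s : BinSeq n) : Set (BinSeq n) :=
  Set.range (fun k : Fin n => rotR k s) ∩ BUnion n c

/-- The set `R(n, c)` of all representative sequences in `B(n, c)`. -/
def R (n c : ℕ) [NeZero n] : Set (BinSeq n) :=
  ⋃ s ∈ BUnion n c, {r | r ∈ E c s ∧ ∀ a ∈ E c s, add c a ≤ add c r}

/-- The lower bounds `c₀`, in the range `c₀ ≥ ⌊n/2⌋` in which `B(n, c)` is defined, such that for
every `c ≥ c₀` all members of `B(n, c)` are representative sequences. -/
def representativeBounds (n : ℕ) [NeZero n] : Set ℕ :=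
  {c₀ | n / 2 ≤ c₀ ∧ ∀ c ≥ c₀, BUnion n c ⊆ R n c}

end NLC

/-!
For a sequence `s` of length `n` let `U` be its periodic extension to the integers. A *run* of shift
`d` is a maximal interval on which `U k = U (k + d)`. Some shift register of length `M` generates `U`
if and only if all runs, of all shifts not divisible by `n`, are shorter than `M`. If `s` lies in
`B(n, c, d)`, then `U` has the run `[-add(s), c - 1)` of shift `d`, so that at least `c + add(s)`
stages are needed, while the theorem of Fine and Wilf gives `nlc(s) = c`. The formula for the
periodic complexity thus says that no run is longer than this one. It also makes `s` representative,
since a rotation of `s` in `B(n, c)` with a larger value of `add` would have a longer run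
(`HasSpacing.mem_R_and_nlcPeriodic_eq`).

Suppose that a run of shift `e ≤ n / 2` is longer than the run of shift `d`, and put `m = n - c` and
`g = gcd(d, e)`. The two runs carry words with periods `d` and `e`. On the circle of length `n` these
words overlap twice, and by the theorem of Fine and Wilf each overlap is shorter than `d + e - g`,
as the word of length `d` is aperiodic (`overlaps_lt`). Next, `e ≤ m`: otherwise the function
`U k + U (k + d) + U (k + e) + U (k + d + e)`, computed from either run, would have incompatible
supports (`shift_le_of_runs`). Counting the letters of the two overlaps now yields `n ≤ 4 m - 4`,
which settles `c ≥ ⌊3 n / 4⌋`. In the remaining cases `n = 4 m - 4` and `n = 4 m - 8` almost all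
inequalities are sharp. The same function is then supported on two short intervals, which forces
`n = 2 (d + e)` and equal deficits of both overlaps (`support_shape`); a parity argument finishes
the proof (`not_shapes`).

The bound is sharp because of the following sequences. For coprime `d < e` let `w` be the Christoffel
word of length `N = d + e` that differs from its shift by `d` only in two adjacent letters. The
sequence of period `2 N` formed by the shift of `w` followed by `w` has a run of shift `d` and
length `2 d + e - 2`, and a run of shift `e` that is longer by `e - d` (`doubled`). So its rotation
that begins with the first run is not representative in `B(2 N, 2 d + e - 1)`
(`not_BUnion_subset_R`), and `e - d ∈ {1, 2, 4}` covers the even residues of `n` modulo `8`.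
-/

namespace NLC

/-! ### Words with two periods -/

/-- The restriction of `U` to the interval `[a, b)` has period `p`. -/
def PeriodOn {α : Type*} (U : ℤ → α) (a b : ℤ) (p : ℕ) : Prop :=
  ∀ k, a ≤ k → k + p < b → U k = U (k + p)

/-- The word that `U` carries on `[a, b)`, which has period `d` in the applications, is not
compatible with a proper divisor of `d` as a period. -/
def PrimitiveOn {α : Type*} (U : ℤ → α) (a b : ℤ) (d : ℕ) : Prop :=
  ∀ g, g ∣ d → PeriodOn U a b g → g = d

section Period

variable {α : Type*} {U : ℤ → α} {a b : ℤ} {p q : ℕ}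

theorem PeriodOn.mono (h : PeriodOn U a b p) {a' b' : ℤ} (ha : a ≤ a') (hb : b' ≤ b) :
    PeriodOn U a' b' p :=
  fun k h1 h2 => h k (by omega) (by omega)

theorem PeriodOn.eq_add_mul (h : PeriodOn U a b p) (j : ℕ) :
    ∀ k, a ≤ k → k + (p * j : ℕ) < b → U k = U (k + (p * j : ℕ)) := by
  induction j with
  | zero => intro k _ _; simp
  | succ j ih =>
    intro k h1 h2
    have e : p * (j + 1) = p * j + p := by ring
    rw [e] at h2 ⊢
    push_cast at h2 ih ⊢
    have := mul_nonneg (Int.natCast_nonneg p) (Int.natCast_nonneg j)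
    rw [ih k h1 (by omega), h _ (by omega) (by omega)]
    congr 1
    ring

theorem PeriodOn.eq_of_dvd_sub (h : PeriodOn U a b p) {k l : ℤ} (hk : a ≤ k) (hk' : k < b)
    (hl : a ≤ l) (hl' : l < b) (hd : (p : ℤ) ∣ l - k) : U k = U l := by
  wlog hkl : k ≤ l generalizing k l
  · exact (this hl hl' hk hk' (by rw [← neg_sub]; exact hd.neg_right) (by omega)).symm
  obtain ⟨j, hj⟩ : p ∣ (l - k).toNat := by
    rw [← Int.natCast_dvd_natCast, Int.toNat_of_nonneg (by omega)]; exact hd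
  have e : l = k + (p * j : ℕ) := by omega
  rw [e]
  exact h.eq_add_mul j k hk (by omega)

/-- Every integer can be moved, in steps of length `p`, into a given interval of length `p`. -/
theorem exists_mem_of_dvd_sub (hp : 0 < p) (o k : ℤ) :
    ∃ k', o ≤ k' ∧ k' < o + p ∧ (p : ℤ) ∣ k' - k := by
  have hp' : (0 : ℤ) < p := by exact_mod_cast hp
  refine ⟨o + (k - o) % p, by have := Int.emod_nonneg (k - o) hp'.ne'; omega,
    by have := Int.emod_lt_of_pos (k - o) hp'; omega, ?_⟩
  refine ⟨-((k - o) / p), ?_⟩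
  have := Int.emod_add_mul_ediv (k - o) p
  linear_combination this

/-- Let `p` divide a period `q` of a word. If `p` is a period of a subword of length at least `q`, then
it is a period of the whole word. -/
theorem PeriodOn.extend (h : PeriodOn U a b q) (hq : 0 < q) (hd : p ∣ q) {o o' : ℤ} (ho : a ≤ o)
    (ho' : o' ≤ b) (hlen : o + q ≤ o') (hg : PeriodOn U o o' p) : PeriodOn U a b p := by
  intro k h1 h2
  obtain ⟨k₁, h3, h4, h5⟩ := exists_mem_of_dvd_sub hq o k
  obtain ⟨k₂, h6, h7, h8⟩ := exists_mem_of_dvd_sub hq o (k + p)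
  have hd' : (p : ℤ) ∣ q := Int.natCast_dvd_natCast.2 hd
  rw [h.eq_of_dvd_sub h1 (by omega) (by omega) (by omega) h5,
    h.eq_of_dvd_sub (k := k + p) (by omega) h2 (by omega) (by omega) h8]
  refine hg.eq_of_dvd_sub h3 (by omega) h6 (by omega) ?_
  have e : k₂ - k₁ = (k₂ - (k + p)) - (k₁ - k) + p := by ring
  rw [e]
  exact (((hd'.trans h8).sub (hd'.trans h5)).add dvd_rfl)

/-- The theorem of Fine and Wilf: a word of length at least `p + q - gcd p q` with periods `p` and
`q` has period `gcd p q`. -/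
theorem PeriodOn.gcd (hp : 0 < p) (hq : 0 < q) (h1 : PeriodOn U a b p) (h2 : PeriodOn U a b q)
    (hlen : (p : ℤ) + q - Nat.gcd p q ≤ b - a) : PeriodOn U a b (Nat.gcd p q) := by
  induction hs : p + q using Nat.strong_induction_on generalizing p q b with
  | _ s ih =>
  subst hs
  wlog hpq : p ≤ q generalizing p q
  · rw [Nat.gcd_comm]
    refine this hq hp h2 h1 (by rw [Nat.gcd_comm]; omega) (fun m hm => ?_) (by omega)
    exact ih m (by omega)
  rcases hpq.eq_or_lt with rfl | hpq
  · simpa using h1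
  -- The Euclidean step: without its last `p` letters the word has period `q - p`.
  have hg : Nat.gcd p (q - p) = Nat.gcd p q := Nat.gcd_sub_self_right hpq.le
  have hgp : Nat.gcd p q ∣ p := Nat.gcd_dvd_left p q
  have hgpos : 0 < Nat.gcd p q := Nat.gcd_pos_of_pos_left _ hp
  have hgle : Nat.gcd p q ≤ q - p :=
    Nat.le_of_dvd (by omega) (hg ▸ Nat.gcd_dvd_right p (q - p))
  have hgp' : Nat.gcd p q ≤ p := Nat.le_of_dvd hp hgp
  have h3 : PeriodOn U a (b - p) (q - p) := by
    intro k h3 h4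
    have e : U k = U (k + q) := h2 k h3 (by omega)
    have e' : U (k + (q - p : ℕ)) = U (k + (q - p : ℕ) + p) := h1 _ (by omega) (by omega)
    rw [e, e']
    congr 1
    omega
  have h4 : PeriodOn U a (b - p) (Nat.gcd p q) := by
    have := ih (p + (q - p)) (by omega) hp (by omega) (h1.mono le_rfl (by omega)) h3
      (by rw [hg]; omega) rfl
    rwa [hg] at this
  exact h1.extend hp hgp le_rfl (o' := b - p) (by omega) (by omega) h4

/-- If a word with a primitive period `d` overlaps a word with period `e` in at least
`d + e - gcd d e` letters, then `d ∣ e` and the union of the two words has period `d`. -/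
theorem PeriodOn.union_of_overlap {a' b' : ℤ} {d e : ℕ} (hd : 0 < d) (he : 0 < e)
    (h1 : PeriodOn U a b d) (hprim : PrimitiveOn U a b d) (h2 : PeriodOn U a' b' e)
    (hov : (d : ℤ) + e - Nat.gcd d e ≤ min b b' - max a a') :
    d ∣ e ∧ PeriodOn U (min a a') (max b b') d := by
  have hgd : Nat.gcd d e ≤ d := Nat.gcd_le_left _ hd
  have hge : Nat.gcd d e ≤ e := Nat.gcd_le_right _ he
  have hg : PeriodOn U (max a a') (min b b') (Nat.gcd d e) :=
    PeriodOn.gcd hd he (h1.mono (by omega) (by omega)) (h2.mono (by omega) (by omega)) hov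
  have hg1 : PeriodOn U a b (Nat.gcd d e) :=
    h1.extend hd (Nat.gcd_dvd_left _ _) (o := max a a') (o' := min b b') (by omega) (by omega)
      (by omega) hg
  have hg2 : PeriodOn U a' b' (Nat.gcd d e) :=
    h2.extend he (Nat.gcd_dvd_right _ _) (o := max a a') (o' := min b b') (by omega) (by omega)
      (by omega) hg
  have hgeq := hprim _ (Nat.gcd_dvd_left _ _) hg1
  rw [hgeq] at hg2 hov
  refine ⟨hgeq ▸ Nat.gcd_dvd_right d e, fun k h3 h4 => ?_⟩
  by_cases hk : a ≤ k ∧ k + d < b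
  · exact h1 k hk.1 hk.2
  · exact hg2 k (by omega) (by omega)

end Period

/-! ### Two runs of a periodic sequence -/

section Runs

variable {U : ℤ → ZMod 2} {n L₁ L₂ r : ℤ} {d e : ℕ}

/-- The word carried by a maximal run of shift `d` and the word carried by a longer run of
shift `e` have a short overlap: otherwise the second word would be a part of the first. -/
theorem overlap_lt (hd : 0 < d) (he : 0 < e) (h1 : PeriodOn U 0 (L₁ + d) d)
    (hprim : PrimitiveOn U 0 (L₁ + d) d) (hleft : U (-1) ≠ U (-1 + d))
    (hright : U L₁ ≠ U (L₁ + d)) (h2 : PeriodOn U r (r + L₂ + e) e) (hL : L₁ < L₂) :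
    min (L₁ + d) (r + L₂ + e) - max 0 r < (d : ℤ) + e - Nat.gcd d e := by
  by_contra! hov
  have hge : Nat.gcd d e ≤ e := Nat.gcd_le_right _ he
  obtain ⟨hde, hU⟩ := h1.union_of_overlap hd he hprim h2 hov
  have hde' := Nat.le_of_dvd he hde
  have hr : 0 ≤ r := by
    by_contra! hr
    exact hleft (hU _ (by omega) (by omega))
  have hr' : r + L₂ + e ≤ L₁ + d := by
    by_contra! hr'
    exact hright (hU _ (by omega) (by omega))
  omega

theorem PeriodOn.sub_period {α : Type*} {U : ℤ → α} {n a b : ℤ} {p : ℕ}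
    (hper : ∀ k, U (k + n) = U k) (h : PeriodOn U a b p) : PeriodOn U (a - n) (b - n) p := by
  intro k h1 h2
  rw [← hper k, ← hper (k + p), h (k + n) (by omega) (by omega)]
  congr 1
  ring

/-- On a circle two runs overlap twice; this bounds both overlaps. -/
theorem overlaps_lt (hper : ∀ k, U (k + n) = U k) (hd : 0 < d) (he : 0 < e)
    (h1 : PeriodOn U 0 (L₁ + d) d) (hprim : PrimitiveOn U 0 (L₁ + d) d)
    (hleft : U (-1) ≠ U (-1 + d)) (hright : U L₁ ≠ U (L₁ + d))
    (h2 : PeriodOn U r (r + L₂ + e) e) (hL : L₁ < L₂) (hr0 : 0 ≤ r) (hrn : r < n)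
    (heL : e ≤ L₁ + Nat.gcd d e) (hdL : d ≤ L₂ + Nat.gcd d e) :
    L₁ - e + Nat.gcd d e + 1 ≤ r ∧ r + L₂ + Nat.gcd d e + 1 ≤ n + d := by
  have i1 := overlap_lt hd he h1 hprim hleft hright h2 hL
  have h2' : PeriodOn U (r - n) (r - n + L₂ + e) e :=
    (h2.sub_period hper).mono le_rfl (by omega)
  have i2 := overlap_lt hd he h1 hprim hleft hright h2' hL
  omega

/-- If a run of shift `d` covers all but at most `m + 1` terms of the period and a run of shift
`e ≤ n / 2` covers all but at most `m`, then `e ≤ m`. The function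
`S k = U k + U (k + d) + U (k + e) + U (k + d + e)` vanishes on a long interval by the second run,
while by the first run it is nonzero at `L₁ - e`, `n - 1 - e`, `L₁` and `n - 1`. -/
theorem shift_le_of_runs {m : ℤ} (hper : ∀ k, U (k + n) = U k) (hd : 0 < d) (hdm : d ≤ m)
    (hen : 2 * (e : ℤ) ≤ n) (h1 : ∀ k, 0 ≤ k → k < L₁ → U k = U (k + d))
    (hleft : U (-1) ≠ U (-1 + d)) (hright : U L₁ ≠ U (L₁ + d))
    (h2 : ∀ k, r ≤ k → k < r + L₂ → U k = U (k + e))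
    (hr0 : 0 ≤ r) (hrn : r < n) (hL1 : n - m - 1 ≤ L₁) (hL1n : L₁ < n) (hL : L₁ < L₂)
    (hm : 2 ≤ m) (hnm : 3 * m - 1 ≤ n) : e ≤ m := by
  by_contra! hem
  obtain ⟨f, hf⟩ : ∃ f : ℤ → ZMod 2, ∀ k, f k = U k + U (k + d) := ⟨_, fun _ => rfl⟩
  obtain ⟨h, hh⟩ : ∃ h : ℤ → ZMod 2, ∀ k, h k = U k + U (k + e) := ⟨_, fun _ => rfl⟩
  obtain ⟨S, hS⟩ : ∃ S : ℤ → ZMod 2, ∀ k, S k = f k + f (k + e) := ⟨_, fun _ => rfl⟩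
  have hS' : ∀ k, S k = h k + h (k + d) := by
    intro k
    rw [hS, hf, hf, hh, hh, add_right_comm k (e : ℤ) d]
    ring
  have fper : ∀ k, f (k + n) = f k := by
    intro k; rw [hf, hf, hper, add_right_comm, hper]
  have hper' : ∀ k, h (k + n) = h k := by
    intro k; rw [hh, hh, hper, add_right_comm, hper]
  have Sper : ∀ k, S (k + n) = S k := by
    intro k; rw [hS, hS, fper, add_right_comm, fper]
  have f0 : ∀ k, 0 ≤ k → k < L₁ → f k = 0 := by
    intro k hk hk'
    rw [hf, ← h1 k hk hk']
    exact CharTwo.add_self_eq_zero _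
  have h0 : ∀ k, r ≤ k → k < r + L₂ → h k = 0 := by
    intro k hk hk'
    rw [hh, ← h2 k hk hk']
    exact CharTwo.add_self_eq_zero _
  have f0' : ∀ k, n ≤ k → k < n + L₁ → f k = 0 := by
    intro k hk hk'
    have := f0 (k - n) (by omega) (by omega)
    rw [← fper] at this
    simpa using this
  have fL : f L₁ ≠ 0 := by
    rw [hf]; intro h; exact hright (CharTwo.add_eq_zero.1 h)
  have fn : f (n - 1) ≠ 0 := by
    have : f (-1) ≠ 0 := by
      rw [hf]; intro h; exact hleft (CharTwo.add_eq_zero.1 h)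
    rwa [← fper, neg_add_eq_sub] at this
  have S1 : S (L₁ - e) ≠ 0 := by
    rw [hS, f0 _ (by omega) (by omega)]; simpa using fL
  have S2 : S (n - 1 - e) ≠ 0 := by
    rw [hS, f0 _ (by omega) (by omega)]; simpa using fn
  have S3 : S L₁ ≠ 0 := by
    rw [hS, f0' (L₁ + e) (by omega) (by omega)]; simpa using fL
  have S4 : S (n - 1) ≠ 0 := by
    rw [hS, f0' (n - 1 + e) (by omega) (by omega)]; simpa using fn
  have S1' : S (L₁ - e + n) ≠ 0 := by rwa [Sper]
  have J : ∀ k, r ≤ k → k + d < r + L₂ → S k = 0 := by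
    intro k hk hk'
    rw [hS', h0 k hk (by omega), h0 (k + d) (by omega) hk', add_zero]
  have Jlen : n - m ≤ L₂ := by omega
  have avoid : ∀ k, S k ≠ 0 → k < r ∨ r + L₂ ≤ k + d := by
    intro k hk
    by_contra! hk'
    exact hk (J k hk'.1 hk'.2)
  have a1 := avoid _ S1
  have a2 := avoid _ S2
  have a3 := avoid _ S3
  have a4 := avoid _ S4
  have a5 := avoid _ S1'
  -- The zeros of `S` fit only between `L₁ - e` and `n - 1 - e`, or between `L₁` and `n - 1`,
  -- and only with equality in all estimates.
  have key : (r = L₁ - e + 1 ∨ r = L₁ + 1) ∧ (d : ℤ) = m ∧ L₁ = n - m - 1 ∧ L₂ = n - m ∧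
      n = 3 * m - 1 := by omega
  obtain ⟨hr, hdm, hL1e, hL2e, hn⟩ := key
  have shift : ∀ k, r + m - 1 ≤ k → k < r + 2 * m - 1 → S (k + m) = S k := by
    intro k hk hk'
    rw [hS', hS', hdm, h0 k (by omega) (by omega)]
    have : h (k + m + m) = 0 := by
      have := h0 (k + m + m - n) (by omega) (by omega)
      rw [← hper'] at this
      simpa using this
    rw [this, zero_add, add_zero]
  have Sr : S (r - 1) ≠ 0 ∧ S (r + m - 1) ≠ 0 := by
    rcases hr with hr | hr
    · refine ⟨?_, ?_⟩
      · rwa [show r - 1 = L₁ - e by omega]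
      · rwa [show r + m - 1 = n - 1 - e by omega]
    · refine ⟨?_, ?_⟩
      · rwa [show r - 1 = L₁ by omega]
      · rwa [show r + m - 1 = n - 1 by omega]
  have T1 : S (r + 2 * m - 1) ≠ 0 := by
    rw [show r + 2 * m - 1 = r + m - 1 + m by ring, shift _ (by omega) (by omega)]
    exact Sr.2
  have T2 : S (r + 2 * m - 2) ≠ 0 := by
    rw [← shift _ (by omega) (by omega), show r + 2 * m - 2 + m = r - 1 + n by omega, Sper]
    exact Sr.1
  have fgap : ∀ k, L₁ < k → k < n - 1 → f k = 0 := by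
    intro k hk hk'
    rcases hr with hr | hr
    · have := J (k - e) (by omega) (by omega)
      rw [hS, f0 (k - e) (by omega) (by omega), zero_add] at this
      simpa using this
    · have := J k (by omega) (by omega)
      rwa [hS, f0' (k + e) (by omega) (by omega), add_zero] at this
  rcases hr with hr | hr
  · apply T1
    rw [hS, fgap _ (by omega) (by omega), f0' _ (by omega) (by omega), add_zero]
  · apply T2
    have := Sper (r + 2 * m - 2 - n)
    rw [sub_add_cancel] at this
    rw [this, hS, f0 _ (by omega) (by omega), fgap _ (by omega) (by omega), add_zero]

end Runs

/-- The shape of a function `F` supported in `[0, w)` such that `F t + F (t - e)` is supported in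
the two short intervals `[0, x)` and `[w + e - y, w + e)`. -/
theorem support_shape {F : ℤ → ZMod 2} {w e x y : ℤ}
    (hneg : ∀ t, -e ≤ t → t < 0 → F t = 0) (hbig : ∀ t, w ≤ t → t < w + e → F t = 0)
    (h0 : F 0 ≠ 0) (hw : F (w - 1) ≠ 0)
    (hmid : ∀ t, x ≤ t → t < w + e - y → F t = F (t - e))
    (hx : F (x - 1) ≠ F (x - 1 - e)) (hy : F (w + e - y) ≠ F (w - y))
    (hx1 : 1 ≤ x) (hxe : x ≤ e) (hy1 : 1 ≤ y) (hye : y ≤ e) :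
    (w ≤ e → w ≤ x) ∧
    (x + y ≤ w → x + e ≤ w ∧ y + e ≤ w ∧ (w ≤ 2 * e → x = w - e ∧ y = w - e)) := by
  have hx' : F (x - 1) ≠ 0 := by rwa [hneg (x - 1 - e) (by omega) (by omega)] at hx
  have hy' : F (w - y) ≠ 0 := by
    rw [hbig (w + e - y) (by omega) (by omega)] at hy; exact hy.symm
  have z1 : ∀ t, F t ≠ 0 → x ≤ t → t < w + e - y → e ≤ t := by
    intro t ht h1 h2
    by_contra! h3
    exact ht ((hmid t h1 h2).trans (hneg _ (by omega) (by omega)))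
  have z2 : ∀ t, F t ≠ 0 → w - e ≤ t → x - e ≤ t → w - y ≤ t := by
    intro t ht h1 h2
    by_contra! h3
    have := hmid (t + e) (by omega) (by omega)
    rw [hbig (t + e) (by omega) (by omega), add_sub_cancel_right] at this
    exact ht this.symm
  refine ⟨fun hwe => ?_, fun hxy => ?_⟩
  · by_contra! hlt
    have := z1 (w - 1) hw (by omega) (by omega)
    omega
  · have i1 := z1 (w - y) hy' (by omega) (by omega)
    have i2 : x + e ≤ w := by
      by_contra! hlt
      have := z2 (x - 1) hx' (by omega) (by omega)
      omega
    refine ⟨i2, by omega, fun hwe => ?_⟩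
    have j1 : F (w - 1 - e) ≠ 0 := by
      rwa [← hmid (w - 1) (by omega) (by omega)]
    have j2 : F e ≠ 0 := by
      rw [hmid e (by omega) (by omega), sub_self]
      exact h0
    have k1 : w - 1 - e < x := by
      by_contra! hlt
      have := z1 _ j1 hlt (by omega)
      omega
    have k2 := z2 e j2 (by omega) (by omega)
    omega

/-- The shape of the differences `U k + U (k + d)` outside a run `[a, a + L)` of shift `d`, in the
presence of a run `[b, b + L')` of shift `e`. The second run makes
`U k + U (k + d) + U (k + e) + U (k + e + d)` vanish on `[b, b + L' - d)`. -/
theorem shape_of_runs {U : ℤ → ZMod 2} {n a L b L' x y : ℤ} {d e : ℕ}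
    (hper : ∀ k, U (k + n) = U k)
    (h1 : ∀ k, a ≤ k → k < a + L → U k = U (k + d))
    (hleft : U (a - 1) ≠ U (a - 1 + d)) (hright : U (a + L) ≠ U (a + L + d))
    (h2 : ∀ k, b ≤ k → k < b + L' → U k = U (k + e))
    (hleft2 : U (b - 1) ≠ U (b - 1 + e)) (hright2 : U (b + L') ≠ U (b + L' + e))
    (hx : b = a + L - e + x) (hy : b + L' = n + d + a - y)
    (hx1 : 1 ≤ x) (hxe : x ≤ e) (hy1 : 1 ≤ y) (hye : y ≤ e)
    (hdL : (d : ℤ) ≤ L') (heL : (e : ℤ) ≤ L) (hd : 0 < d) :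
    (n - L ≤ e → n - L ≤ x) ∧
    (x + y ≤ n - L → x + e ≤ n - L ∧ y + e ≤ n - L ∧
      (n - L ≤ 2 * e → x = n - L - e ∧ y = n - L - e)) := by
  have f0 : ∀ k, a ≤ k → k < a + L → U k + U (k + d) = 0 :=
    fun k hk hk' => CharTwo.add_eq_zero.2 (h1 k hk hk')
  have g0 : ∀ k, b ≤ k → k < b + L' → U k + U (k + e) = 0 :=
    fun k hk hk' => CharTwo.add_eq_zero.2 (h2 k hk hk')
  have hperd : ∀ k, U (k + n) + U (k + n + d) = U k + U (k + d) := by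
    intro k; rw [hper, add_right_comm, hper]
  have comm : ∀ k, U k + U (k + d) + (U (k + e) + U (k + e + d)) =
      U k + U (k + e) + (U (k + d) + U (k + d + e)) := by
    intro k; rw [add_right_comm k (e : ℤ) d]; ring
  have szero : ∀ k, b ≤ k → k < b + L' - d → U k + U (k + d) = U (k + e) + U (k + e + d) := by
    intro k hk hk'
    rw [← CharTwo.add_eq_zero, comm, g0 k hk (by omega), g0 (k + d) (by omega) (by omega),
      add_zero]
  have sone : U (b - 1) + U (b - 1 + d) ≠ U (b - 1 + e) + U (b - 1 + e + d) := by
    rw [Ne, ← CharTwo.add_eq_zero, comm, g0 (b - 1 + d) (by omega) (by omega), add_zero,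
      CharTwo.add_eq_zero]
    exact hleft2
  have sone' : U (b + L' - d) + U (b + L' - d + d) ≠
      U (b + L' - d + e) + U (b + L' - d + e + d) := by
    rw [Ne, ← CharTwo.add_eq_zero, comm, g0 (b + L' - d) (by omega) (by omega), zero_add,
      sub_add_cancel, CharTwo.add_eq_zero]
    exact hright2
  refine support_shape (F := fun t => U (a + L + t) + U (a + L + t + d)) (w := n - L)
    (e := e) (x := x) (y := y) ?_ ?_ ?_ ?_ ?_ ?_ ?_ hx1 hxe hy1 hye
  · exact fun t i1 i2 => f0 _ (by omega) (by omega)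
  · intro t i1 i2
    have := f0 (a + L + t - n) (by omega) (by omega)
    rwa [← hperd, sub_add_cancel] at this
  · rw [Ne, CharTwo.add_eq_zero, add_zero]
    exact hright
  · rw [show a + L + (n - L - 1) = a - 1 + n by ring, hperd, Ne, CharTwo.add_eq_zero]
    exact hleft
  · intro t i1 i2
    have := szero (a + L + (t - e)) (by omega) (by omega)
    rw [this, show a + L + (t - e) + e = a + L + t by ring]
  · rw [show a + L + (x - 1) = b - 1 + e by omega, show a + L + (x - 1 - e) = b - 1 by omega]
    exact sone.symm
  · rw [show a + L + (n - L + e - y) = b + L' - d + e by omega,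
      show a + L + (n - L - y) = b + L' - d by omega]
    exact sone'.symm

/-- The range of parameters covered by the theorem, in terms of the period `n` and of `m = n - c`: in
this range the run that makes `s` a member of `B(n, c)` is the longest run of the periodic
sequence. -/
def Admissible (n m : ℤ) : Prop :=
  4 * m - 3 ≤ n ∨ (n = 4 * m - 4 ∧ 3 ≤ m) ∨ (n = 4 * m - 8 ∧ 7 ≤ m ∧ ¬ 2 ∣ m)

/-- The arithmetic that excludes two runs of lengths `n - w₁ < n - w₂` and shifts `d`, `e` when
`n = 4 m - 4` or `n = 4 m - 8`; `x` and `y` measure the deficits of the two overlaps. -/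
theorem not_shapes {n m w₁ w₂ x y : ℤ} {d e : ℕ} (hd : 0 < d) (he : 0 < e)
    (hn : (n = 4 * m - 4 ∧ 3 ≤ m) ∨ (n = 4 * m - 8 ∧ 7 ≤ m ∧ ¬ 2 ∣ m))
    (hw1 : w₁ ≤ m + 1) (hw : w₂ < w₁) (hdm : d ≤ m) (hem : e ≤ m)
    (hx : Nat.gcd d e + 1 ≤ x) (hy : Nat.gcd d e + 1 ≤ y) (hxy : x + y = w₁ + w₂ + d + e - n)
    (hA : (w₁ ≤ e → w₁ ≤ x) ∧ (x + y ≤ w₁ → x + e ≤ w₁ ∧ y + e ≤ w₁ ∧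
      (w₁ ≤ 2 * e → x = w₁ - e ∧ y = w₁ - e)))
    (hB : (w₂ ≤ d → w₂ ≤ y) ∧ (y + x ≤ w₂ → y + d ≤ w₂ ∧ x + d ≤ w₂ ∧
      (w₂ ≤ 2 * d → y = w₂ - d ∧ x = w₂ - d))) : False := by
  have hgpos : 0 < Nat.gcd d e := Nat.gcd_pos_of_pos_left _ hd
  have hde : (d : ℤ) ≠ e := by
    intro h
    obtain rfl : d = e := by exact_mod_cast h
    rw [Nat.gcd_self] at hx hy
    clear hA hB
    omega
  obtain ⟨B1, B2⟩ := hB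
  have hxe : x + e ≤ w₁ ∧ y + e ≤ w₁ ∧ (w₁ ≤ 2 * e → x = w₁ - e ∧ y = w₁ - e) := by
    refine hA.2 ?_
    clear hA B1 B2
    omega
  clear hA
  obtain ⟨A2, A3, A4⟩ := hxe
  have hB : y + x ≤ w₂ := by
    clear B2 A4
    by_contra! hlt
    have hwd : w₂ ≤ d := by clear B1; omega
    have := B1 hwd
    clear B1
    omega
  clear B1
  obtain ⟨B2, B3, B4⟩ := B2 hB
  obtain ⟨A5, A6⟩ := A4 (by clear A4 B4; omega)
  clear A4
  by_cases hd3 : d = 3 ∧ e = 6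
  · obtain ⟨rfl, rfl⟩ := hd3
    norm_num at hx hy
    clear B4
    omega
  obtain ⟨B5, B6⟩ := B4 (by clear B4; omega)
  clear B4
  have : 2 ≤ Nat.gcd d e := Nat.le_of_dvd hgpos (Nat.dvd_gcd (by omega) (by omega))
  omega

/-- No run of a sequence of period `n` is longer than a maximal run of shift `d` and length at
least `n - m - 1` whose word is primitive. -/
theorem not_lt_of_runs {U : ℤ → ZMod 2} {n m L₁ L₂ r : ℤ} {d e : ℕ}
    (hper : ∀ k, U (k + n) = U k) (hd : 0 < d) (hdm : d ≤ m) (he : 0 < e)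
    (hen : 2 * (e : ℤ) ≤ n) (hadm : Admissible n m) (hmn : 2 * m ≤ n + 1)
    (hL1 : n - m - 1 ≤ L₁)
    (hprim : PrimitiveOn U 0 (L₁ + d) d)
    (h1 : ∀ k, 0 ≤ k → k < L₁ → U k = U (k + d))
    (hleft : U (-1) ≠ U (-1 + d)) (hright : U L₁ ≠ U (L₁ + d))
    (h2 : ∀ k, r ≤ k → k < r + L₂ → U k = U (k + e))
    (hleft2 : U (r - 1) ≠ U (r - 1 + e)) (hright2 : U (r + L₂) ≠ U (r + L₂ + e))
    (hr0 : 0 ≤ r) (hrn : r < n) : ¬ L₁ < L₂ := by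
  intro hL
  have hgpos : 0 < Nat.gcd d e := Nat.gcd_pos_of_pos_left _ hd
  have hL2n : L₂ < n := by
    by_contra! hlt
    apply hleft2
    have := h2 (r - 1 + n) (by omega) (by omega)
    rwa [hper, add_right_comm, hper] at this
  unfold Admissible at hadm
  obtain ⟨hx, hy⟩ := overlaps_lt hper hd he (fun k i1 i2 => h1 k i1 (by omega)) hprim hleft hright
    (r := r) (L₂ := L₂) (fun k i1 i2 => h2 k i1 (by omega)) hL hr0 hrn (by omega) (by omega)
  have hem : (e : ℤ) ≤ m := by
    by_cases hm : 2 ≤ m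
    · exact shift_le_of_runs hper hd hdm hen h1 hleft hright h2 hr0 hrn hL1 (by omega) hL hm
        (by omega)
    · omega
  have hde : d ≠ e := by
    rintro rfl
    rw [Nat.gcd_self] at hx hy
    omega
  rcases hadm with hadm | hadm
  -- If `4 m - 3 ≤ n`, the bounds on the overlaps are already contradictory.
  · omega
  have A := shape_of_runs (a := 0) (L := L₁) (b := r) (L' := L₂) (x := r - L₁ + e)
    (y := n + d - r - L₂) hper (by simpa using h1) (by simpa using hleft) (by simpa using hright)
    h2 hleft2 hright2 (by ring) (by ring) (by omega) (by omega) (by omega) (by omega) (by omega)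
    (by omega) hd
  have h1' : ∀ k, n ≤ k → k < n + L₁ → U k = U (k + d) := by
    intro k hk hk'
    have := h1 (k - n) (by omega) (by omega)
    rwa [← hper, ← hper (k - n + d), add_right_comm, sub_add_cancel] at this
  have B := shape_of_runs (a := r) (L := L₂) (b := n) (L' := L₁) (x := n + d - r - L₂)
    (y := r - L₁ + e) hper h2 hleft2 hright2 h1'
    (by
      rw [show n - 1 = -1 + n by ring, add_right_comm, hper, hper]
      exact hleft)
    (by
      rw [add_comm n, add_right_comm, hper, hper]
      exact hright)
    (by ring) (by ring) (by omega) (by omega) (by omega) (by omega) (by omega) (by omega) he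
  exact not_shapes hd he hadm (by omega) (by omega) hdm hem (by omega) (by omega) (by ring) A B

/-! ### Finite sequences and their periodic extensions -/

/-- The extension of `s` to a sequence of period `n` indexed by all integers. -/
def zext {n : ℕ} [NeZero n] (s : BinSeq n) : ℤ → ZMod 2 :=
  fun k => periodize s (k % n).toNat

section Basic

variable {n : ℕ} [NeZero n] {s : BinSeq n} {c d : ℕ}

theorem natCast_pos_of_neZero (n : ℕ) [NeZero n] : (0 : ℤ) < n := by
  exact_mod_cast Nat.pos_of_neZero n

theorem periodize_mod (s : BinSeq n) (i : ℕ) : periodize s (i % n) = periodize s i := by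
  unfold periodize
  congr 1
  ext
  simp [Fin.ofNat]

theorem zext_natCast (s : BinSeq n) (i : ℕ) : zext s i = periodize s i := by
  unfold zext
  rw [← Int.natCast_mod, Int.toNat_natCast, periodize_mod]

theorem zext_of_nonneg (s : BinSeq n) {k : ℤ} (hk : 0 ≤ k) : zext s k = periodize s k.toNat := by
  rw [← zext_natCast, Int.toNat_of_nonneg hk]

theorem zext_eq_of_dvd_sub (s : BinSeq n) {k l : ℤ} (h : (n : ℤ) ∣ l - k) :
    zext s k = zext s l := by
  unfold zext
  rw [Int.modEq_iff_dvd.2 h]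

theorem zext_add_period (s : BinSeq n) (k : ℤ) : zext s (k + n) = zext s k :=
  (zext_eq_of_dvd_sub s (by simp)).symm

theorem periodOn_zext_iff {b g : ℕ} (hg : 0 < g) :
    PeriodOn (zext s) 0 b g ↔ ∀ i < b, periodize s i = periodize s (i % g) := by
  constructor
  · intro h i hi
    rw [← zext_natCast, ← zext_natCast]
    have := Nat.mod_le i g
    refine h.eq_of_dvd_sub (by omega) (by omega) (by omega) (by omega) ?_
    refine ⟨-((i / g : ℕ) : ℤ), ?_⟩
    have : ((g * (i / g) + i % g : ℕ) : ℤ) = i := by rw [Nat.div_add_mod]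
    push_cast at this ⊢
    linear_combination this
  · intro h k hk hkb
    rw [zext_of_nonneg s hk, zext_of_nonneg s (by omega), h _ (by omega),
      h (k + g).toNat (by omega), show (k + g).toNat = k.toNat + g by omega, Nat.add_mod_right]

theorem aperiodicPrefix_iff :
    AperiodicPrefix (periodize s) d ↔ ∀ g ∈ d.properDivisors, ¬ PeriodOn (zext s) 0 d g := by
  unfold AperiodicPrefix
  simp only [not_exists, not_and]
  refine forall₂_congr fun g hg => ?_
  rw [periodOn_zext_iff (Nat.pos_of_mem_properDivisors hg)]

theorem AperiodicPrefix.primitiveOn (h : AperiodicPrefix (periodize s) d) (hd : 0 < d) {a b : ℤ}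
    (ha : a ≤ 0) (hb : d ≤ b) : PrimitiveOn (zext s) a b d := by
  intro g hg hU
  by_contra hne
  refine aperiodicPrefix_iff.1 h g (Nat.mem_properDivisors.2 ⟨hg, ?_⟩) (hU.mono ha hb)
  exact lt_of_le_of_ne (Nat.le_of_dvd hd hg) hne

/-- The conditions that define `B(n, c, d)`, in terms of the run of shift `d` of the periodic
extension: the run covers `[0, c - 1)` and ends at `c - 1`. -/
structure HasSpacing (s : BinSeq n) (c d : ℕ) : Prop where
  half_le : n / 2 ≤ c
  pos : 0 < d
  le_sub : d ≤ n - c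
  le_half : d ≤ n / 2
  aperiodic : AperiodicPrefix (periodize s) n
  aperiodic_word : AperiodicPrefix (periodize s) d
  periodOn : PeriodOn (zext s) 0 (c - 1 + d) d
  ne : zext s (c - 1) ≠ zext s (c - 1 + d)

theorem mem_B_iff : s ∈ B n c d ↔ HasSpacing s c d := by
  have key : n / 2 ≤ c → 1 ≤ d → d ≤ min (n - c) (n / 2) →
      ((∀ j < c + d - 1, periodize s j = periodize s (j % d)) ∧
        periodize s (c + d - 1) = periodize s ((c + d - 1) % d) + 1 ↔
      PeriodOn (zext s) 0 (c - 1 + d) d ∧ zext s (c - 1) ≠ zext s (c - 1 + d)) := by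
    intro h1 h2 h3
    have e1 : ((c : ℤ) - 1 + d) = (c + d - 1 : ℕ) := by omega
    have e2 : ((c : ℤ) - 1) = (c - 1 : ℕ) := by omega
    rw [e1, periodOn_zext_iff h2]
    refine and_congr_right fun h6 => ?_
    have e3 : (c + d - 1) % d = (c - 1) % d := by
      rw [show c + d - 1 = c - 1 + d by omega, Nat.add_mod_right]
    rw [e2, zext_natCast, zext_natCast, e3, ← h6 (c - 1) (by omega)]
    generalize periodize s (c + d - 1) = x
    generalize periodize s (c - 1) = y
    revert x y
    decide
  constructor
  · rintro ⟨h1, h2, h3, h4, h5, h6⟩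
    obtain ⟨h7, h8⟩ := (key h1 h2 h3).1 h6
    exact ⟨h1, h2, h3.trans (min_le_left _ _), h3.trans (min_le_right _ _), h4, h5, h7, h8⟩
  · rintro ⟨h1, h2, h3, h3', h4, h5, h7, h8⟩
    have h3 := le_min h3 h3'
    exact ⟨h1, h2, h3, h4, h5, (key h1 h2 h3).2 ⟨h7, h8⟩⟩

theorem HasSpacing.primitiveOn (h : HasSpacing s c d) {a b : ℤ} (ha : a ≤ 0) (hb : d ≤ b) :
    PrimitiveOn (zext s) a b d :=
  h.aperiodic_word.primitiveOn h.pos ha hb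

/-- The sets `B(n, c, d)` with different `d` are disjoint, by the theorem of Fine and Wilf. -/
theorem HasSpacing.spacing_unique {d' : ℕ} (h : HasSpacing s c d) (h' : HasSpacing s c d') :
    d = d' := by
  have key : ∀ {d d' : ℕ}, HasSpacing s c d → HasSpacing s c d' → d ∣ d' := by
    intro d d' h h'
    have := h.half_le; have := h.le_half; have := h'.le_half; have := h.pos; have := h'.pos
    have := Nat.gcd_pos_of_pos_left d' h.pos
    exact (h.periodOn.union_of_overlap h.pos h'.pos (h.primitiveOn le_rfl (by omega))
      h'.periodOn (by omega)).1
  exact Nat.dvd_antisymm (key h h') (key h' h)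

theorem spacing_eq (h : HasSpacing s c d) : spacing c s = d := by
  have : {d | s ∈ B n c d} = {d} := by
    ext d'
    exact ⟨fun h' => (h.spacing_unique (mem_B_iff.1 h')).symm, fun h' => h' ▸ mem_B_iff.2 h⟩
  rw [spacing, this, csInf_singleton]

theorem zext_sub_one_sub (s : BinSeq n) {t : ℕ} (ht : t < n) :
    periodize s (n - 1 - t) = zext s (-1 - t) := by
  rw [← zext_natCast, ← zext_add_period s (-1 - t)]
  congr 1
  omega

/-- The first `add(s)` terms to the left of the origin continue the run of shift `d`, and the next
one breaks it. -/
theorem HasSpacing.add_spec (h : HasSpacing s c d) : add c s < n ∧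
    (∀ k : ℤ, -(add c s : ℤ) ≤ k → k < 0 → zext s k = zext s (k + d)) ∧
    zext s (-(add c s : ℤ) - 1) ≠ zext s (-(add c s : ℤ) - 1 + d) := by
  have hd : (0 : ℤ) < d := by exact_mod_cast h.pos
  obtain ⟨P, hP⟩ : ∃ P : ℕ → Prop, ∀ t, P t ↔ t < n ∧
      zext s (-1 - t) ≠ zext s (((d : ℤ) - 1 - t) % (d : ℤ)) := ⟨_, fun _ => Iff.rfl⟩
  have hadd : add c s = sInf {t | P t} := by
    rw [add, spacing_eq h, addOfSpacing]
    congr 1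
    ext t
    simp only [Set.mem_ofPred_eq, hP]
    refine and_congr_right fun ht => ?_
    rw [zext_sub_one_sub s ht, zext_of_nonneg s (Int.emod_nonneg _ hd.ne')]
  -- The reduction modulo `d` in the definition of `add` has no effect as long as all
  -- previous terms agree.
  have step : ∀ t : ℕ, t < n → (∀ t' < t, ¬ P t') →
      zext s (((d : ℤ) - 1 - t) % (d : ℤ)) = zext s (-1 - t + d) := by
    intro t ht hprev
    by_cases htd : t < d
    · rw [Int.emod_eq_of_lt (by omega) (by omega)]
      congr 1
      ring
    · have := hprev (t - d) (by have := h.pos; omega)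
      simp only [hP, ne_eq, not_and, not_not] at this
      have := this (by omega)
      rw [show (d : ℤ) - 1 - (t - d : ℕ) = d - 1 - t + d by omega, Int.add_emod_right] at this
      rw [← this]
      congr 1
      omega
  have hne : ∃ t, P t := by
    by_contra! hall
    have hneg : ∀ t : ℕ, t < n → zext s (-1 - t) = zext s (-1 - t + d) := by
      intro t ht
      rw [← step t ht (fun t' _ => hall t')]
      have := hall t
      simp only [hP, ne_eq, not_and, not_not] at this
      exact this ht
    have := h.le_sub
    have := h.pos
    have := hneg (n - c) (by have := h.half_le; have := h.le_half; omega)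
    rw [← zext_add_period, ← zext_add_period s (_ + (d : ℤ)), add_right_comm,
      show (-1 - ((n - c : ℕ) : ℤ) + n) = c - 1 by omega] at this
    exact h.ne this
  have hmem : P (add c s) := by rw [hadd]; exact Nat.sInf_mem hne
  have hmin : ∀ t < add c s, ¬ P t := by
    intro t ht
    rw [hadd] at ht
    exact Nat.notMem_of_lt_sInf ht
  have hA := (hP _).1 hmem
  refine ⟨hA.1, fun k hk hk0 => ?_, ?_⟩
  · have ht := hmin (-1 - k).toNat (by omega)
    simp only [hP, ne_eq, not_and, not_not] at ht
    have e : k = -1 - ((-1 - k).toNat : ℤ) := by omega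
    have := ht (by omega)
    rw [step _ (by omega) (fun t' ht' => hmin t' (by omega)), ← e] at this
    exact this
  · rw [step _ hA.1 hmin] at hA
    rw [show -(add c s : ℤ) - 1 = -1 - add c s by ring]
    exact hA.2

end Basic

/-! ### Feedback shift registers -/

section Registers

variable {u : ℕ → ZMod 2} {N : ℕ∞} {M : ℕ}

/-- A shift register of length `M` exists as soon as equal windows of length `M` have equal
successors. -/
theorem exists_generates
    (h : ∀ i j : ℕ, ((i + M : ℕ) : ℕ∞) < N → ((j + M : ℕ) : ℕ∞) < N →
      (∀ t < M, u (i + t) = u (j + t)) → u (i + M) = u (j + M)) :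
    ∃ f, Generates M f u N := by
  classical
  refine ⟨fun w => if hw : ∃ i : ℕ, ((i + M : ℕ) : ℕ∞) < N ∧ ∀ t : Fin M, u (i + t) = w t
    then u (hw.choose + M) else 0, fun i hi => ?_⟩
  have hw : ∃ i' : ℕ, ((i' + M : ℕ) : ℕ∞) < N ∧ ∀ t : Fin M, u (i' + t) = u (i + t) :=
    ⟨i, hi, fun _ => rfl⟩
  simp only [dif_pos hw]
  exact h _ _ hi hw.choose_spec.1 fun t ht => (hw.choose_spec.2 ⟨t, ht⟩).symm

theorem Generates.eq_of_window {f : (Fin M → ZMod 2) → ZMod 2} (h : Generates M f u N) {i j : ℕ}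
    (hi : ((i + M : ℕ) : ℕ∞) < N) (hj : ((j + M : ℕ) : ℕ∞) < N)
    (hw : ∀ t < M, u (i + t) = u (j + t)) : u (i + M) = u (j + M) := by
  rw [h i hi, h j hj]
  congr 1
  ext t
  rw [hw t t.2]

end Registers

section Complexity

variable {n : ℕ} [NeZero n] {s : BinSeq n} {c d : ℕ}

theorem nlc_eq (h : HasSpacing s c d) : nlc s = c := by
  have h1 := h.half_le; have h2 := h.le_half; have h3 := h.pos; have h4 := h.le_sub
  refine IsLeast.csInf_eq ⟨exists_generates ?_, ?_⟩
  · intro i j hi hj hw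
    have hi' : i + c < n := by exact_mod_cast hi
    have hj' : j + c < n := by exact_mod_cast hj
    clear hi hj
    wlog hij : i < j generalizing i j
    · rcases (not_lt.1 hij).eq_or_lt with rfl | hji
      · rfl
      · exact (this j i (fun t ht => (hw t ht).symm) hj' hi' hji).symm
    have hper : PeriodOn (zext s) i (j + c) (j - i) := by
      intro k hk hk'
      have := hw (k - i).toNat (by omega)
      rw [← zext_natCast, ← zext_natCast] at this
      rw [show k = ((i + (k - i).toNat : ℕ) : ℤ) by omega, this]
      congr 1
      omega
    have hgpos := Nat.gcd_pos_of_pos_left (j - i) h3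
    obtain ⟨hd, hU⟩ := h.periodOn.union_of_overlap h3 (by omega)
      (h.primitiveOn le_rfl (by omega)) hper (by omega)
    have hle := Nat.le_of_dvd (by omega) hd
    exact absurd (hU (c - 1) (by omega) (by omega)) h.ne
  · rintro M ⟨f, hf⟩
    by_contra! hM
    have := hf.eq_of_window (i := c - 1 - M) (j := c - 1 - M + d)
      (by exact_mod_cast (by omega : c - 1 - M + M < n))
      (by exact_mod_cast (by omega : c - 1 - M + d + M < n)) (fun t ht => by
        rw [← zext_natCast, ← zext_natCast, h.periodOn _ (by omega) (by omega)]
        congr 1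
        omega)
    rw [← zext_natCast, ← zext_natCast] at this
    apply h.ne
    convert this using 2 <;> omega

theorem HasSpacing.run (h : HasSpacing s c d) {k : ℤ} (hk : -(add c s : ℤ) ≤ k) (hk' : k < c - 1) :
    zext s k = zext s (k + d) := by
  by_cases h0 : k < 0
  · exact h.add_spec.2.1 k hk h0
  · exact h.periodOn k (by omega) (by omega)

/-- The run of shift `d`, extended to the left by `add(s)` terms, requires a long register. -/
theorem HasSpacing.le_of_generates (h : HasSpacing s c d) {M : ℕ} {f : (Fin M → ZMod 2) → ZMod 2}
    (hf : Generates M f (periodize s) ⊤) : c + add c s ≤ M := by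
  by_contra! hM
  have hA := h.add_spec.1
  have h1 := h.half_le; have h2 := h.le_half; have h3 := h.pos
  have := hf.eq_of_window (i := n + c - 1 - M) (j := n + c - 1 - M + d)
    (ENat.natCast_lt_top _) (ENat.natCast_lt_top _) (fun t ht => by
      rw [← zext_natCast, ← zext_natCast]
      have := h.run (k := ((n + c - 1 - M + t : ℕ) : ℤ) - n) (by omega) (by omega)
      rw [← zext_add_period, ← zext_add_period s (_ + (d : ℤ)), add_right_comm,
        sub_add_cancel] at this
      rw [this]
      congr 1
      omega)
  rw [← zext_natCast, ← zext_natCast] at this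
  apply h.ne
  rw [← zext_add_period, ← zext_add_period s (_ + (d : ℤ))]
  convert this using 2 <;> omega

/-- For admissible parameters the run of shift `d`, extended to the left by `add(s)` terms, is the
longest run of the periodic sequence, so that a register of length `c + add(s)` suffices. -/
theorem HasSpacing.exists_generates (h : HasSpacing s c d) (hadm : Admissible n (n - c : ℤ)) :
    ∃ f, Generates (c + add c s) f (periodize s) ⊤ := by
  have h1 := h.half_le; have h2 := h.le_half; have h3 := h.pos; have h4 := h.le_sub
  obtain ⟨hA, -, hleft⟩ := h.add_spec
  have hn := natCast_pos_of_neZero n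
  set A := add c s with hAdef
  -- Two equal windows with different successors give a run of some shift `e ≤ n / 2`.
  suffices key : ∀ (e : ℕ) (r : ℤ), 0 < e → 2 * e ≤ n →
      (∀ k, r ≤ k → k < r + (c + A) → zext s k = zext s (k + e)) →
      zext s (r + (c + A)) = zext s (r + (c + A) + e) by
    refine NLC.exists_generates fun i j _ _ hw => ?_
    -- Take for `e` the residue of `j - i` or of `i - j` modulo `n`, whichever is at most `n / 2`.
    rw [← zext_natCast, ← zext_natCast]
    obtain ⟨e, he⟩ : ∃ e : ℕ, (e : ℤ) = ((j : ℤ) - i) % n :=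
      ⟨(((j : ℤ) - i) % n).toNat, Int.toNat_of_nonneg (Int.emod_nonneg _ hn.ne')⟩
    have hen : (e : ℤ) < n := he ▸ Int.emod_lt_of_pos _ hn
    have hdvd : (n : ℤ) ∣ (j : ℤ) - i - e := he ▸ Int.dvd_self_sub_emod
    have hj : ∀ k l : ℤ, l = k - i + j → zext s (k + e) = zext s l := by
      rintro k l rfl
      refine zext_eq_of_dvd_sub s ?_
      convert hdvd using 1
      ring
    have hj' : ∀ k l : ℤ, l = k - i + j → zext s k = zext s (l + (n - e : ℕ)) := by
      rintro k l rfl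
      refine zext_eq_of_dvd_sub s ?_
      rw [Nat.cast_sub (by omega)]
      rw [show k - i + j + ((n : ℤ) - e) - k = (j - i - e) + n by ring]
      exact dvd_add hdvd dvd_rfl
    have hw' : ∀ k : ℤ, (i : ℤ) ≤ k → k < i + (c + A) → zext s k = zext s (k - i + j) := by
      intro k hk hk'
      have := hw (k - i).toNat (by omega)
      rw [← zext_natCast, ← zext_natCast] at this
      convert this using 2 <;> omega
    rcases Nat.eq_zero_or_pos e with rfl | hepos
    · refine zext_eq_of_dvd_sub s ?_
      convert hdvd using 1
      push_cast
      ring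
    · rcases le_total (2 * e) n with h2e | h2e
      · have := key e i hepos h2e fun k hk hk' => by
          rw [hj k _ rfl]; exact hw' k hk hk'
        push_cast
        rw [this]
        exact hj _ _ (by ring)
      · have := key (n - e) j (by omega) (by omega) fun k hk hk' => by
          rw [← hj' (k - j + i) k (by ring), hw' (k - j + i) (by omega) (by omega)]
          congr 1
          ring
        push_cast
        rw [this]
        exact hj' _ _ (by ring)
  intro e r he hen hrun
  by_contra hright
  -- The run has a left end, as it would otherwise reach a translate of its right end.
  have hex : ∃ t : ℕ, zext s (r - 1 - t) ≠ zext s (r - 1 - t + e) := by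
    refine ⟨((c + A) * (n - 1) + n - 1 : ℕ), ?_⟩
    have e1 : (((c + A) * (n - 1) + n - 1 : ℕ) : ℤ) = (c + A + 1) * n - (c + A) - 1 := by
      have := Nat.pos_of_neZero n
      rw [Nat.add_sub_assoc (by omega)]
      push_cast [Nat.cast_sub this]
      ring
    rw [e1]
    intro heq
    apply hright
    rw [← zext_eq_of_dvd_sub s (k := r - 1 - ((c + A + 1) * n - (c + A) - 1))
      (l := r + (c + A)) ⟨(c + A + 1 : ℤ), by ring⟩, heq]
    exact zext_eq_of_dvd_sub s ⟨(c + A + 1 : ℤ), by ring⟩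
  classical
  obtain ⟨t, ht, hmin⟩ : ∃ t : ℕ, zext s (r - 1 - t) ≠ zext s (r - 1 - t + e) ∧
      ∀ t' < t, zext s (r - 1 - t') = zext s (r - 1 - t' + e) :=
    ⟨Nat.find hex, Nat.find_spec hex, fun t' h' => not_not.1 (Nat.find_min hex h')⟩
  have hrun' : ∀ k, r - t ≤ k → k < r + (c + A) → zext s k = zext s (k + e) := by
    intro k hk hk'
    by_cases hkr : r ≤ k
    · exact hrun k hkr hk'
    · have := hmin (r - 1 - k).toNat (by omega)
      rwa [show r - 1 - ((r - 1 - k).toNat : ℤ) = k by omega] at this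
  -- Translate the first run to the origin, and the second one by a multiple of `n`.
  obtain ⟨q, hq⟩ : ∃ q : ℤ, (r - t + A) = (r - t + A) % n + n * q :=
    ⟨_, (Int.emod_add_mul_ediv _ _).symm⟩
  have htr : ∀ k : ℤ, zext s (k - A) = zext s (k - A + n * q) := fun k =>
    zext_eq_of_dvd_sub s ⟨q, by ring⟩
  have hr0 := Int.emod_nonneg (r - t + A) hn.ne'
  have hrn := Int.emod_lt_of_pos (r - t + A) hn
  set r' := (r - t + A) % n with hr'
  refine not_lt_of_runs (U := fun k => zext s (k - A)) (n := n) (m := n - c) (L₁ := c - 1 + A)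
    (L₂ := c + A + t) (r := r') (d := d) (e := e) ?_ h3 (by omega) he (by omega) hadm (by omega)
    (by omega) ?_ ?_ ?_ ?_ ?_ ?_ ?_ hr0 hrn (by omega)
  · intro k
    rw [add_sub_right_comm, zext_add_period]
  · intro g hg hU
    refine h.primitiveOn (a := -A) (b := c - 1 + d) (by omega) (by omega) g hg fun k hk hk' => ?_
    have := hU (k + A) (by omega) (by omega)
    simp only at this
    convert this using 2 <;> ring
  · intro k hk hk'
    rw [h.run (by omega) (by omega)]
    congr 1
    ring
  · convert hleft using 2 <;> ring
  · convert h.ne using 2 <;> ring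
  · intro k hk hk'
    rw [htr, htr (k + e), hrun' _ (by omega) (by omega)]
    congr 1
    ring
  · rw [htr, htr (r' - 1 + e), show r' - 1 - A + n * q = r - 1 - t by omega,
      show r' - 1 + e - A + n * q = r - 1 - t + e by omega]
    exact ht
  · rw [htr, htr (r' + (c + A + t) + e), show r' + (c + A + t) - A + n * q = r + (c + A) by omega,
      show r' + (c + A + t) + e - A + n * q = r + (c + A) + e by omega]
    exact hright

end Complexity

/-! ### Representative sequences -/

section Representatives

variable {n : ℕ} [NeZero n] {s : BinSeq n} {c d : ℕ}

theorem mem_BUnion_iff : s ∈ BUnion n c ↔ ∃ d, HasSpacing s c d :=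
  exists_congr fun _ => mem_B_iff

theorem zext_rotR (k : Fin n) (s : BinSeq n) (x : ℤ) : zext (rotR k s) x = zext s (x - k) := by
  obtain ⟨i, hi⟩ : ∃ i : ℕ, (i : ℤ) = x % n :=
    ⟨(x % n).toNat, Int.toNat_of_nonneg (Int.emod_nonneg _ (natCast_pos_of_neZero n).ne')⟩
  have hin : i < n := by
    have := Int.emod_lt_of_pos x (natCast_pos_of_neZero n)
    omega
  have e1 : zext (rotR k s) x = periodize s (n - k + i) := by
    unfold zext
    rw [← hi, Int.toNat_natCast]
    unfold periodize rotR
    congr 1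
    ext
    simp [Fin.ofNat, Fin.sub_def]
  rw [e1, ← zext_natCast]
  refine zext_eq_of_dvd_sub s ?_
  have := k.2
  have h2 : (n : ℤ) ∣ x - x % n := Int.dvd_self_sub_emod
  rw [show x - k - ((n - k + i : ℕ) : ℤ) = (x - x % n) - n by omega]
  exact dvd_sub h2 dvd_rfl

theorem eq_of_zext_eq {t : BinSeq n} (h : ∀ x, zext s x = zext t x) : s = t := by
  funext i
  have := h i
  rw [zext_natCast, zext_natCast] at this
  simpa [periodize, Fin.ofNat, Nat.mod_eq_of_lt i.2] using this

theorem generates_rotR {M : ℕ} {f : (Fin M → ZMod 2) → ZMod 2} (k : Fin n)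
    (h : Generates M f (periodize s) ⊤) : Generates M f (periodize (rotR k s)) ⊤ := by
  have e : ∀ i, periodize (rotR k s) i = periodize s (i + (n - k)) := by
    intro i
    rw [← zext_natCast, zext_rotR, ← zext_natCast, ← zext_add_period]
    congr 1
    have := k.2
    omega
  intro i _
  rw [e, add_right_comm, h _ (ENat.natCast_lt_top _)]
  congr 1
  funext j
  rw [e, add_right_comm]

/-- For admissible parameters `add` is determined by the complexity of the periodic sequence, which
a rotation does not change. -/
theorem HasSpacing.mem_R_and_nlcPeriodic_eq (h : HasSpacing s c d)
    (hadm : Admissible n (n - c : ℤ)) :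
    s ∈ R n c ∧ nlcPeriodic s = nlc s + add c s := by
  obtain ⟨f, hf⟩ := h.exists_generates hadm
  have hmem : s ∈ BUnion n c := mem_BUnion_iff.2 ⟨d, h⟩
  refine ⟨?_, ?_⟩
  · refine Set.mem_iUnion₂.2 ⟨s, hmem, ⟨⟨0, ?_⟩, hmem⟩, ?_⟩
    · refine eq_of_zext_eq fun x => ?_
      rw [zext_rotR]
      simp
    · rintro a ⟨⟨k, rfl⟩, ha⟩
      obtain ⟨d', hd'⟩ := mem_BUnion_iff.1 ha
      have := hd'.le_of_generates (generates_rotR k hf)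
      omega
  · rw [nlc_eq h]
    refine IsLeast.csInf_eq ⟨⟨f, hf⟩, ?_⟩
    rintro M ⟨f', hf'⟩
    exact h.le_of_generates hf'

end Representatives

/-! ### Sequences that are not representative -/

section Christoffel

/-- For coprime `d` and `N` there is a word of period `N`, a Christoffel word, that differs from
its shift by `d` in only two adjacent places of each period. Along the steps of length `d` the
residues modulo `N` form one cycle; the word is constant on the two arcs into which `-1` and `-2`
cut this cycle. -/
theorem exists_christoffel {d N : ℕ} (hN : 2 ≤ N) (hco : Nat.Coprime d N) :
    ∃ w : ℤ → ZMod 2, (∀ t, w (t + N) = w t) ∧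
      ∀ t, w t ≠ w (t + d) ↔ (N : ℤ) ∣ t + d + 1 ∨ (N : ℤ) ∣ t + d + 2 := by
  have hN0 : (0 : ℤ) < N := by omega
  obtain ⟨v, hv⟩ : ∃ v : ℤ, v * d % N = 1 := by
    have h1 : (d : ℤ) * Nat.gcdA d N + N * Nat.gcdB d N = 1 := by
      rw [← Nat.gcd_eq_gcd_ab, hco]
      rfl
    refine ⟨Nat.gcdA d N, ?_⟩
    rw [show (Nat.gcdA d N : ℤ) * d = 1 + N * (-Nat.gcdB d N) by linear_combination h1,
      Int.add_mul_emod_self_left]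
    exact Int.emod_eq_of_lt (by omega) (by omega)
  -- The position of `t` on the cycle, starting from `-1`.
  obtain ⟨p, hp⟩ : ∃ p : ℤ → ℤ, ∀ t, p t = v * (t + 1) % N := ⟨_, fun _ => rfl⟩
  obtain ⟨v₀, hv₀⟩ : ∃ v₀, v₀ = v % N := ⟨_, rfl⟩
  have hp0 : ∀ t, 0 ≤ p t := fun t => hp t ▸ Int.emod_nonneg _ hN0.ne'
  have hpN : ∀ t, p t < N := fun t => hp t ▸ Int.emod_lt_of_pos _ hN0
  have hv00 : 0 ≤ v₀ := hv₀ ▸ Int.emod_nonneg _ hN0.ne'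
  have hv0N : v₀ < N := hv₀ ▸ Int.emod_lt_of_pos _ hN0
  have hv0 : v₀ ≠ 0 := by
    intro h
    rw [Int.mul_emod, ← hv₀, h] at hv
    simp at hv
  have hvinj : ∀ z : ℤ, (N : ℤ) ∣ v * z ↔ (N : ℤ) ∣ z := by
    have h1 : (N : ℤ) ∣ v * d - 1 := by
      rw [← Int.emod_emod_of_dvd _ (dvd_refl (N : ℤ))] at hv
      exact Int.ModEq.dvd (a := 1) (b := v * d) (by
        rw [Int.ModEq, Int.emod_eq_of_lt (a := 1) (by omega) (by omega), ← hv,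
          Int.emod_emod_of_dvd _ dvd_rfl])
    intro z
    refine ⟨fun h => ?_, fun h => h.mul_left v⟩
    have : z = d * (v * z) - z * (v * d - 1) := by ring
    rw [this]
    exact dvd_sub (h.mul_left _) (h1.mul_left _)
  have hstep : ∀ t, p (t + d) = (p t + 1) % N := by
    intro t
    rw [hp, hp, show v * (t + d + 1) = v * (t + 1) + v * d by ring, Int.add_emod, hv]
  have hz1 : ∀ t, p t = 0 ↔ (N : ℤ) ∣ t + 1 := by
    intro t
    rw [hp, ← Int.dvd_iff_emod_eq_zero, hvinj]
  have hz2 : ∀ t, p t = N - v₀ ↔ (N : ℤ) ∣ t + 2 := by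
    intro t
    rw [← hvinj, show v * (t + 2) = v * (t + 1) + v by ring, Int.dvd_iff_emod_eq_zero,
      Int.add_emod, ← hp, ← hv₀]
    have := hp0 t
    have := hpN t
    constructor
    · intro h
      rw [h, sub_add_cancel, Int.emod_self]
    · intro h
      rw [← Int.dvd_iff_emod_eq_zero] at h
      obtain ⟨q, hq⟩ := h
      have q0 : 0 < q := by
        by_contra! hle
        have := mul_nonpos_of_nonneg_of_nonpos hN0.le hle
        omega
      have q2 : q < 2 := by
        by_contra! hle
        have := mul_le_mul_of_nonneg_left hle hN0.le
        omega
      obtain rfl : q = 1 := by omega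
      omega
  refine ⟨fun t => if p t + v₀ < N then 1 else 0, fun t => ?_, fun t => ?_⟩
  · have : p (t + N) = p t := by
      rw [hp, hp, show v * (t + N + 1) = v * (t + 1) + N * v by ring, Int.add_mul_emod_self_left]
    simp only [this]
  · have h1 := hp0 t
    have h2 := hpN t
    change (if p t + v₀ < N then (1 : ZMod 2) else 0) ≠ (if p (t + d) + v₀ < N then 1 else 0) ↔ _
    rw [← hz1, ← hz2, hstep]
    by_cases hlast : p t + 1 = N
    · rw [hlast, Int.emod_self, if_neg (by omega), if_pos (by omega)]
      simp
    · rw [Int.emod_eq_of_lt (by omega) (by omega)]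
      split_ifs <;> simp <;> omega

end Christoffel

section Tightness

/-- `w` has period `d + e`, and in each period it differs from its shift by `d` exactly at the
places `-2` and `-1`. -/
structure IsChristoffel (w : ℤ → ZMod 2) (d e : ℕ) : Prop where
  period : ∀ t, w (t + (d + e)) = w t
  eq_sub : ∀ t : ℤ, 0 ≤ t → t < d + e - 2 → w (t - d) = w t
  ne_one : w (-1 - d) ≠ w (-1)
  ne_two : w (-2 - d) ≠ w (-2)

theorem exists_isChristoffel {d e : ℕ} (hd : 0 < d) (he : 0 < e) (hco : Nat.Coprime d e) :
    ∃ w, IsChristoffel w d e := by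
  obtain ⟨w, h1, h2⟩ := exists_christoffel (d := d) (N := d + e) (by omega) (by simpa using hco)
  refine ⟨w, ⟨by simpa using h1, fun t ht ht' => ?_, ?_, ?_⟩⟩
  · by_contra hne
    have := (h2 (t - d)).1 (by simpa using hne)
    rw [sub_add_cancel] at this
    rcases this with h | h
    · have := Int.le_of_dvd (by omega) h
      omega
    · have := Int.le_of_dvd (by omega) h
      omega
  · have := (h2 (-1 - d)).2 (Or.inl (by simp))
    rwa [sub_add_cancel] at this
  · have := (h2 (-2 - d)).2 (Or.inr (by simp))
    rwa [sub_add_cancel] at this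

/-- The sequence of period `2 N` whose period consists of the word of length `N` of the shift of
`w` by `d`, followed by the word of length `N` of `w` itself. -/
def doubled (w : ℤ → ZMod 2) (d N : ℕ) : ℤ → ZMod 2 :=
  fun i => if i % (2 * N) < N then w (i - d) else w i

theorem doubled_low (w : ℤ → ZMod 2) (d : ℕ) {N : ℕ} {i : ℤ}
    (hi : 0 ≤ i ∧ i < N ∨ 2 * N ≤ i ∧ i < 3 * N) : doubled w d N i = w (i - d) := by
  refine if_pos ?_
  rcases hi with hi | hi
  · rw [Int.emod_eq_of_lt (by omega) (by omega)]
    omega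
  · rw [← Int.sub_emod_right, Int.emod_eq_of_lt (by omega) (by omega)]
    omega

theorem doubled_high (w : ℤ → ZMod 2) (d : ℕ) {N : ℕ} {i : ℤ}
    (hi : -N ≤ i ∧ i < 0 ∨ N ≤ i ∧ i < 2 * N) : doubled w d N i = w i := by
  refine if_neg ?_
  rcases hi with hi | hi
  · rw [← Int.add_emod_right, Int.emod_eq_of_lt (by omega) (by omega)]
    omega
  · rw [Int.emod_eq_of_lt (by omega) (by omega)]
    omega

variable {w : ℤ → ZMod 2} {d e : ℕ}

namespace IsChristoffel

theorem period_two (h : IsChristoffel w d e) (t : ℤ) : w (t + 2 * (d + e)) = w t := by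
  rw [two_mul, ← add_assoc, h.period, h.period]

theorem doubled_period (h : IsChristoffel w d e) (i : ℤ) :
    doubled w d (d + e) (i + 2 * (d + e)) = doubled w d (d + e) i := by
  unfold doubled
  rw [add_sub_right_comm, h.period_two, h.period_two]
  push_cast
  rw [Int.add_emod_right]

theorem eq_sub' (h : IsChristoffel w d e) {t : ℤ} (ht : d + e ≤ t) (ht' : t < 2 * (d + e) - 2) :
    w (t - d) = w t := by
  have := h.eq_sub (t - (d + e)) (by omega) (by omega)
  rw [← h.period, ← h.period (t - (d + e))] at this
  convert this using 2 <;> ring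

theorem doubled_run_d (h : IsChristoffel w d e) (hd : 0 < d) (hde : d < e) :
    PeriodOn (doubled w d (d + e)) (-d) (2 * d + e - 2) d := by
  intro i hi hi'
  rcases lt_or_ge i 0 with h0 | h0
  · rw [doubled_high _ _ (by omega), doubled_low _ _ (by omega), add_sub_cancel_right]
  · rw [doubled_low _ _ (by omega), h.eq_sub i h0 (by omega)]
    rcases lt_or_ge (i + d) (d + e) with h1 | h1
    · rw [doubled_low _ _ (by omega), add_sub_cancel_right]
    · rw [doubled_high _ _ (by omega), ← h.eq_sub' (t := i + d) (by omega) (by omega),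
        add_sub_cancel_right]

theorem doubled_run_d' (h : IsChristoffel w d e) :
    PeriodOn (doubled w d (d + e)) (d + e) (2 * (d + e) - 2) d := by
  intro i hi hi'
  rw [doubled_high _ _ (by omega), doubled_high _ _ (by omega),
    ← h.eq_sub' (t := i + d) (by omega) (by omega), add_sub_cancel_right]

theorem doubled_ne_d (h : IsChristoffel w d e) (hd : 0 < d) (hde : d < e) :
    doubled w d (d + e) (d + e - 2) ≠ doubled w d (d + e) (d + e - 2 + d) := by
  rw [doubled_low _ _ (by omega)]
  have e1 : w ((d : ℤ) + e - 2 - d) = w (-2 - d) := by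
    rw [← h.period (-2 - d)]; congr 1; ring
  have e2 : doubled w d (d + e) (d + e - 2 + d) = w (-2) := by
    rcases lt_or_ge ((d : ℤ) + e - 2 + d) (d + e) with h1 | h1
    · rw [doubled_low _ _ (by omega), ← h.period (-2)]
      congr 1
      omega
    · rw [doubled_high _ _ (by omega), ← h.period (-2),
        ← h.eq_sub' (t := d + e - 2 + d) (by omega) (by omega)]
      congr 1
      ring
  rw [e1, e2]
  exact h.ne_two

theorem doubled_ne_d_one (h : IsChristoffel w d e) (hd : 0 < d) (hde : d < e) :
    doubled w d (d + e) (d + e - 1) ≠ doubled w d (d + e) (d + e - 1 + d) := by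
  rw [doubled_low _ _ (by omega), doubled_high _ _ (by omega),
    ← h.eq_sub' (t := d + e - 1 + d) (by omega) (by omega)]
  have e1 : w ((d : ℤ) + e - 1 - d) = w (-1 - d) := by
    rw [← h.period (-1 - d)]; congr 1; ring
  have e2 : w ((d : ℤ) + e - 1 + d - d) = w (-1) := by
    rw [← h.period (-1)]; congr 1; ring
  rw [e1, e2]
  exact h.ne_one

theorem doubled_ne_left (h : IsChristoffel w d e) (hd : 0 < d) (hde : d < e) {i : ℤ}
    (hi : i = -1 - d ∨ i = -2 - d) :
    doubled w d (d + e) i ≠ doubled w d (d + e) (i + d) := by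
  rcases hi with rfl | rfl
  · rw [doubled_high _ _ (by omega), doubled_high _ _ (by omega), sub_add_cancel]
    exact h.ne_one
  · rw [doubled_high _ _ (by omega), doubled_high _ _ (by omega), sub_add_cancel]
    exact h.ne_two

theorem doubled_run_e (h : IsChristoffel w d e) (hd : 0 < d) (hde : d < e) :
    PeriodOn (doubled w d (d + e)) (e - 1) (2 * d + 3 * e - 2) e := by
  intro i hi hi'
  have back : ∀ t : ℤ, w (t + e) = w (t - d) := by
    intro t; rw [← h.period (t - d)]; congr 1; ring
  rcases lt_or_ge i (d + e) with h0 | h0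
  · rw [doubled_low _ _ (by omega), doubled_high _ _ (by omega), back]
  · rw [doubled_high _ _ (by omega), ← h.eq_sub' h0 (by omega)]
    rcases lt_or_ge (i + e) (2 * (d + e)) with h1 | h1
    · rw [doubled_high _ _ (by omega), back]
    · rw [doubled_low _ _ (by omega), add_sub_right_comm, back,
        h.eq_sub' (t := i - d) (by omega) (by omega)]

theorem doubled_ne_e (h : IsChristoffel w d e) (hd : 0 < d) (hde : d < e) :
    doubled w d (d + e) (2 * (d + e) - 2) ≠ doubled w d (d + e) (2 * (d + e) - 2 + e) := by
  rw [doubled_high _ _ (by omega), doubled_low _ _ (by omega)]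
  have e1 : w (2 * ((d : ℤ) + e) - 2) = w (-2) := by
    rw [← h.period_two (-2)]; exact congrArg w (by ring)
  have e2 : w (2 * ((d : ℤ) + e) - 2 + e - d) = w (-2 - d) := by
    rw [← h.period (-2 - d), show -2 - (d : ℤ) + (d + e) = e - 2 by ring,
      ← h.eq_sub (e - 2) (by omega) (by omega), ← h.period_two (e - 2 - d)]
    congr 1
    ring
  rw [e1, e2]
  exact h.ne_two.symm

theorem not_period_doubled (h : IsChristoffel w d e) (hd : 0 < d) (hde : d < e) {g : ℕ}
    (hg : 0 < g) (hgN : g ≤ d + e) :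
    ¬ ∀ i, doubled w d (d + e) (i + g) = doubled w d (d + e) i := by
  intro hper
  have key : ∀ i : ℤ, i = -1 - d ∨ i = -2 - d →
      doubled w d (d + e) (i + g) ≠ doubled w d (d + e) (i + g + d) := by
    intro i hi
    rw [hper, add_right_comm, hper]
    exact h.doubled_ne_left hd hde hi
  rcases eq_or_ne g 1 with rfl | hg1
  · exact key _ (Or.inl rfl) (h.doubled_run_d hd hde _ (by omega) (by push_cast; omega))
  · exact key _ (Or.inr rfl) (h.doubled_run_d hd hde _ (by omega) (by omega))

/-- A proper divisor `g` of `d` is not a period of the run of shift `d`: with the period `d + e` of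
`w` it would make `w` constant. -/
theorem not_periodOn_d (h : IsChristoffel w d e) (hco : Nat.Coprime d e) (hde : d < e)
    {g : ℕ} (hg : g ∈ d.properDivisors) :
    ¬ PeriodOn (doubled w d (d + e)) (-d) 0 g := by
  intro hper
  obtain ⟨hgd, hlt⟩ := Nat.mem_properDivisors.1 hg
  have hg0 := Nat.pos_of_mem_properDivisors hg
  have hper' : PeriodOn (doubled w d (d + e)) (-d) (2 * d + e - 2) g :=
    (h.doubled_run_d (by omega) hde).extend (by omega) hgd le_rfl (by omega) (by omega) hper
  have hval : ∀ t : ℤ, -d ≤ t → t < d + e - 2 → w t = doubled w d (d + e) (t + d) := by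
    intro t ht ht'
    rcases lt_or_ge (t + d) (d + e) with h1 | h1
    · rw [doubled_low _ _ (by omega), add_sub_cancel_right]
    · rw [doubled_high _ _ (by omega), ← h.eq_sub' (t := t + d) (by omega) (by omega),
        add_sub_cancel_right]
  have hw1 : PeriodOn w (-d) (d + e - 2) g := by
    intro t ht ht'
    rw [hval t ht (by omega), hval (t + g) (by omega) (by omega), add_right_comm]
    exact hper' _ (by omega) (by omega)
  have hw2 : PeriodOn w (-d) (d + e - 2) (d + e) := fun t _ _ => by
    push_cast
    exact (h.period t).symm
  have hgcd : Nat.gcd g (d + e) = 1 :=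
    Nat.Coprime.coprime_dvd_left hgd (by simpa using hco)
  have := PeriodOn.gcd hg0 (by omega) hw1 hw2 (by rw [hgcd]; push_cast; omega)
  rw [hgcd] at this
  apply h.ne_one
  rw [← h.period (-1 - d)]
  exact this.eq_of_dvd_sub (by omega) (by omega) (by omega) (by omega) (by simp)

/-- A proper divisor `g` of `e` is not a period of the run of shift `e`: on the part of this run
that has period `d` as well the sequence would be constant. -/
theorem not_periodOn_e (h : IsChristoffel w d e) (hco : Nat.Coprime d e) (hd : 0 < d)
    (hde : d < e) {g : ℕ} (hg : g ∈ e.properDivisors) :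
    ¬ PeriodOn (doubled w d (d + e)) e (2 * e) g := by
  intro hper
  obtain ⟨hge, hlt⟩ := Nat.mem_properDivisors.1 hg
  have hg0 := Nat.pos_of_mem_properDivisors hg
  have hrun : PeriodOn (doubled w d (d + e)) e (2 * d + 3 * e - 2) e :=
    (h.doubled_run_e hd hde).mono (by omega) le_rfl
  have hper' : PeriodOn (doubled w d (d + e)) e (2 * d + 3 * e - 2) g :=
    hrun.extend (by omega) hge le_rfl (by omega) (by omega) hper
  have hgcd : Nat.gcd d g = 1 := Nat.Coprime.coprime_dvd_right hge hco
  have hconst := PeriodOn.gcd hd hg0 h.doubled_run_d' (hper'.mono (by omega) (by omega))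
    (by rw [hgcd]; push_cast; omega)
  rw [hgcd] at hconst
  have := hper'.extend hg0 (one_dvd g) (o := d + e) (o' := 2 * (d + e) - 2) (by omega) (by omega)
    (by omega) hconst
  exact h.doubled_ne_d_one hd hde
    (this.eq_of_dvd_sub (by omega) (by omega) (by omega) (by omega) (by simp))

end IsChristoffel

variable {n : ℕ} [NeZero n]

/-- The sequence of length `n = 2 (d + e)` read off from `doubled w d (d + e)` at the place `a`. -/
def doubledFrom (w : ℤ → ZMod 2) (d e n : ℕ) (a : ℤ) : BinSeq n :=
  fun i => doubled w d (d + e) (i + a)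

theorem zext_doubledFrom (h : IsChristoffel w d e) (hn : n = 2 * (d + e)) (a k : ℤ) :
    zext (doubledFrom w d e n a) k = doubled w d (d + e) (k + a) := by
  have hper : Function.Periodic (doubled w d (d + e)) n := fun i => by
    rw [hn]
    push_cast
    exact h.doubled_period i
  have hn0 := natCast_pos_of_neZero n
  unfold zext periodize doubledFrom
  have hk : (((k % n).toNat % n : ℕ) : ℤ) = k % n := by
    have := Int.emod_nonneg k hn0.ne'
    have := Int.emod_lt_of_pos k hn0
    rw [Nat.mod_eq_of_lt (by omega)]
    omega
  simp only [Fin.ofNat, hk]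
  rw [← hper.int_mul (k / n) (k % n + a)]
  congr 1
  have := Int.emod_add_mul_ediv k n
  simp only [Int.cast_id]
  linear_combination this

theorem doubledFrom_aperiodic (h : IsChristoffel w d e) (hd : 0 < d) (hde : d < e)
    (hn : n = 2 * (d + e)) (a : ℤ) : AperiodicPrefix (periodize (doubledFrom w d e n a)) n := by
  rw [aperiodicPrefix_iff]
  intro g hg hper
  have hg0 := Nat.pos_of_mem_properDivisors hg
  obtain ⟨⟨q, hq⟩, hlt⟩ := Nat.mem_properDivisors.1 hg
  have hq2 : 2 ≤ q := by
    by_contra! hq2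
    interval_cases q <;> omega
  have hgN : g ≤ d + e := by
    have := Nat.mul_le_mul_left g hq2
    omega
  refine h.not_period_doubled hd hde hg0 hgN fun i => ?_
  -- A period of the finite sequence that divides `n` is a period of its extension.
  have hall : ∀ k, zext (doubledFrom w d e n a) k = zext (doubledFrom w d e n a) (k + g) := by
    intro k
    obtain ⟨k₁, h1, h2, h3⟩ := exists_mem_of_dvd_sub (Nat.pos_of_neZero n) 0 k
    obtain ⟨k₂, h4, h5, h6⟩ := exists_mem_of_dvd_sub (Nat.pos_of_neZero n) 0 (k + g)
    rw [zext_eq_of_dvd_sub _ h3, zext_eq_of_dvd_sub _ h6]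
    refine hper.eq_of_dvd_sub h1 (by omega) h4 (by omega) ?_
    have hgn : (g : ℤ) ∣ n := ⟨q, by exact_mod_cast hq⟩
    rw [show k₂ - k₁ = (k₂ - (k + g)) - (k₁ - k) + g by ring]
    exact ((hgn.trans h6).sub (hgn.trans h3)).add dvd_rfl
  have := hall (i - a)
  rw [zext_doubledFrom h hn, zext_doubledFrom h hn, sub_add_cancel, add_right_comm,
    sub_add_cancel] at this
  exact this.symm

theorem hasSpacing_doubledFrom_d (h : IsChristoffel w d e) (hco : Nat.Coprime d e) (hd : 0 < d)
    (hde : d < e) (hn : n = 2 * (d + e)) :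
    HasSpacing (doubledFrom w d e n (-d)) (2 * d + e - 1) d where
  half_le := by omega
  pos := hd
  le_sub := by omega
  le_half := by omega
  aperiodic := doubledFrom_aperiodic h hd hde hn _
  aperiodic_word := by
    rw [aperiodicPrefix_iff]
    intro g hg hper
    refine h.not_periodOn_d hco hde hg fun k hk hk' => ?_
    have := hper (k + d) (by omega) (by omega)
    rw [zext_doubledFrom h hn, zext_doubledFrom h hn] at this
    convert this using 2 <;> ring
  periodOn := by
    intro k hk hk'
    rw [zext_doubledFrom h hn, zext_doubledFrom h hn, add_right_comm]
    exact h.doubled_run_d hd hde _ (by omega) (by omega)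
  ne := by
    rw [zext_doubledFrom h hn, zext_doubledFrom h hn]
    convert h.doubled_ne_d hd hde using 2 <;> omega

theorem hasSpacing_doubledFrom_e (h : IsChristoffel w d e) (hco : Nat.Coprime d e) (hd : 0 < d)
    (hde : d < e) (hn : n = 2 * (d + e)) :
    HasSpacing (doubledFrom w d e n e) (2 * d + e - 1) e where
  half_le := by omega
  pos := by omega
  le_sub := by omega
  le_half := by omega
  aperiodic := doubledFrom_aperiodic h hd hde hn _
  aperiodic_word := by
    rw [aperiodicPrefix_iff]
    intro g hg hper
    refine h.not_periodOn_e hco hd hde hg fun k hk hk' => ?_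
    have := hper (k - e) (by omega) (by omega)
    rw [zext_doubledFrom h hn, zext_doubledFrom h hn] at this
    convert this using 2 <;> ring
  periodOn := by
    intro k hk hk'
    rw [zext_doubledFrom h hn, zext_doubledFrom h hn, add_right_comm]
    exact h.doubled_run_e hd hde _ (by omega) (by omega)
  ne := by
    rw [zext_doubledFrom h hn, zext_doubledFrom h hn]
    convert h.doubled_ne_e hd hde using 2 <;> omega

/-- For coprime `d < e` and `n = 2 (d + e)` not all members of `B(n, 2 d + e - 1)` are
representative: the sequence `doubledFrom w d e n (-d)` has no added terms, while its rotation
`doubledFrom w d e n e` has. -/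
theorem not_BUnion_subset_R (hco : Nat.Coprime d e) (hd : 0 < d) (hde : d < e)
    (hn : n = 2 * (d + e)) : ¬ BUnion n (2 * d + e - 1) ⊆ R n (2 * d + e - 1) := by
  intro hsub
  obtain ⟨w, h⟩ := exists_isChristoffel hd (hd.trans hde) hco
  have hs := hasSpacing_doubledFrom_d h hco hd hde hn
  have ha := hasSpacing_doubledFrom_e h hco hd hde hn
  have hadd_s : add (2 * d + e - 1) (doubledFrom w d e n (-d)) = 0 := by
    by_contra hne
    have := hs.add_spec.2.1 (-1) (by omega) (by omega)
    rw [zext_doubledFrom h hn, zext_doubledFrom h hn, add_right_comm, ← sub_eq_add_neg] at this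
    exact h.doubled_ne_left hd hde (Or.inl rfl) this
  have hadd_a : add (2 * d + e - 1) (doubledFrom w d e n e) ≠ 0 := by
    intro h0
    have hne := ha.add_spec.2.2
    rw [h0, zext_doubledFrom h hn, zext_doubledFrom h hn, add_right_comm] at hne
    exact hne (h.doubled_run_e hd hde _ (by simp) (by simp; omega))
  obtain ⟨t, -, ⟨⟨k, hk⟩, -⟩, hmax⟩ := Set.mem_iUnion₂.1 (hsub (mem_BUnion_iff.2 ⟨d, hs⟩))
  have := hmax (doubledFrom w d e n e) ⟨⟨k - Fin.ofNat n (d + e), ?_⟩, mem_BUnion_iff.2 ⟨e, ha⟩⟩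
  · omega
  · refine eq_of_zext_eq fun x => ?_
    have hk' : ∀ x, zext t (x - k) = zext (doubledFrom w d e n (-d)) x := fun x => by
      rw [← hk, zext_rotR]
    have hcast : (n : ℤ) ∣ ((k - Fin.ofNat n (d + e) : Fin n) : ℤ) - (k - (d + e)) := by
      rw [Fin.sub_def]
      have h1 : (d + e) % n = d + e := Nat.mod_eq_of_lt (by omega)
      simp only [Fin.ofNat, h1]
      have h2 : (n : ℤ) ∣ ((n - (d + e) + k : ℕ) : ℤ) - ((n - (d + e) + k) % n : ℕ) := by
        rw [Int.natCast_mod]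
        exact Int.dvd_self_sub_emod
      have : (((n - (d + e) + k) % n : ℕ) : ℤ) - (k - (d + e)) =
          n - (((n - (d + e) + k : ℕ) : ℤ) - ((n - (d + e) + k) % n : ℕ)) := by omega
      rw [this]
      exact dvd_sub dvd_rfl h2
    rw [zext_rotR, zext_eq_of_dvd_sub t (l := x + (d + e) - k)
      (by convert hcast using 1; ring), hk', zext_doubledFrom h hn, zext_doubledFrom h hn]
    congr 1
    ring

/-- The least bound follows from a bound and one failure just below it. -/
theorem isLeast_representativeBounds {c₀ : ℕ} (hc : n / 2 ≤ c₀)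
    (hpos : ∀ (c : ℕ) (s : BinSeq n), c₀ ≤ c → s ∈ BUnion n c → s ∈ R n c)
    (hneg : n / 2 < c₀ → ¬ BUnion n (c₀ - 1) ⊆ R n (c₀ - 1)) :
    IsLeast (representativeBounds n) c₀ := by
  refine ⟨⟨hc, fun c hc s hs => hpos c s hc hs⟩, ?_⟩
  rintro b ⟨hb, hb'⟩
  by_contra! hlt
  exact hneg (by omega) (hb' _ (by omega))

end Tightness

end NLC

theorem mainTheorem3 (n : ℕ) [NeZero n] :
    (∀ (c : ℕ) (s : NLC.BinSeq n), 3 * n / 4 ≤ c → s ∈ NLC.BUnion n c →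
      s ∈ NLC.R n c ∧ NLC.nlcPeriodic s = NLC.nlc s + NLC.add c s) ∧
    (∀ k c₀ : ℕ,
      (n = 8 * k ∧ c₀ = 3 * n / 4 - 1) ∨
      ((n = 8 * k + 2 ∨ n = 8 * k + 6) ∧ c₀ = 3 * n / 4) ∨
      (n = 8 * k + 4 ∧ 2 ≤ k ∧ c₀ = 3 * n / 4 - 2) →
        IsLeast (NLC.representativeBounds n) c₀ ∧
        ∀ (c : ℕ) (s : NLC.BinSeq n), c₀ ≤ c → s ∈ NLC.BUnion n c →
          s ∈ NLC.R n c ∧ NLC.nlcPeriodic s = NLC.nlc s + NLC.add c s) := by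
  have hn := Nat.pos_of_neZero n
  refine ⟨fun c s hc hs => ?_, fun k c₀ hk => ?_⟩
  · obtain ⟨d, hd⟩ := NLC.mem_BUnion_iff.1 hs
    exact hd.mem_R_and_nlcPeriodic_eq (Or.inl (by omega))
  have hpos : ∀ (c : ℕ) (s : NLC.BinSeq n), c₀ ≤ c → s ∈ NLC.BUnion n c →
      s ∈ NLC.R n c ∧ NLC.nlcPeriodic s = NLC.nlc s + NLC.add c s := by
    intro c s hc hs
    obtain ⟨d, hd⟩ := NLC.mem_BUnion_iff.1 hs
    refine hd.mem_R_and_nlcPeriodic_eq ?_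
    unfold NLC.Admissible
    omega
  refine ⟨NLC.isLeast_representativeBounds (by omega) (fun c s hc hs => (hpos c s hc hs).1)
    fun hlt => ?_, hpos⟩
  -- Just below `c₀` the shifts `d < e` with `e - d ∈ {1, 2, 4}` give a sequence that is not
  -- representative.
  obtain ⟨d, e, hd, hde, hco, hnde, hc⟩ : ∃ d e, 0 < d ∧ d < e ∧ Nat.Coprime d e ∧
      n = 2 * (d + e) ∧ c₀ - 1 = 2 * d + e - 1 := by
    have hodd : ∀ k, 0 < k → Nat.Coprime (2 * k - 1) 2 := fun k hk =>
      Nat.coprime_two_right.2 ⟨k - 1, by omega⟩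
    rcases hk with ⟨rfl, rfl⟩ | ⟨hk, rfl⟩ | ⟨rfl, hk, rfl⟩
    · refine ⟨2 * k - 1, 2 * k - 1 + 2, by omega, by omega, ?_, by omega, by omega⟩
      simpa using hodd k (by omega)
    · refine ⟨(n - 2) / 4, (n - 2) / 4 + 1, by omega, by omega, ?_, by omega, by omega⟩
      simp
    · refine ⟨2 * k - 1, 2 * k - 1 + 4, by omega, by omega, ?_, by omega, by omega⟩
      simpa using (hodd k (by omega)).pow_right 2
  rw [hc]
  exact NLC.not_BUnion_subset_R hco hd hde hnde
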